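/- A \emph{set system} $S=(E,\mathcal F)$ is a finite set $E$ with a collection $\mathcal F$ of subsets of $E$, called feasible sets; it is proper if $\mathcal F\neq\emptyset$. A \emph{delta-matroid} is a proper set system such that for all $X,Y\in\mathcal F$ and $u\in X\triangle Y$ there is $v\in X\triangle Y$ (possibly $v=u$) with $X\triangle\{u,v\}\in\mathcal F$. For $A\subseteq E$ the \emph{twist} is $S*A=(E,\{F\triangle A:F\in\mathcal F\})$, and for $e\in E$ the \emph{loop complementation} is $S+e=(E,\mathcal F\triangle\{F\cup\{e\}:e\notin F\in\mathcal F\})$. A \emph{twisted dual} of $S$ is a set system obtained from $S$ by a finite (possibly empty) sequence of twists and loop complementations. A delta-matroid is \emph{vf-safe} if all its twisted duals are delta-matroids. Let $S$ be proper and $e\in E$. If some feasible set contains $e$, the contraction is $S/e=(E-\{e\},\{F-\{e\}:e\in F\in\mathcal F\})$; if some feasible set avoids $e$, the deletion is $S\setminus e=(E-\{e\},\{F\in\mathcal F:e\notin F\})$; if only one of these is thereby defined, the other is set equal to it. The \emph{Penrose contraction} is $S\ddagger e=(S+e)/e$. A \emph{$3$-minor} of $S$ is a set system obtained from $S$ by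 a finite (possibly empty) sequence of deletions, contractions and Penrose contractions. A delta-matroid with ground set $E$ is \emph{binary} if, for some symmetric matrix $M$ over $\mathrm{GF}(2)$ with rows and columns indexed by $E$, it is a twist of the set system on $E$ whose feasible sets are the $X\subseteq E$ such that the principal submatrix $M[X]$ is non-singular (the empty matrix being non-singular). \textbf{Corollary.} A vf-safe delta-matroid is binary if and only if it has no $3$-minor that is isomorphic to a twisted dual of \[B_1=(\{a,b,c\},\{\emptyset,\{a,b\},\{a,c\},\{b,c\},\{a,b,c\}\}).\] -/

import Mathlib

open scoped symmDiff

/-- A set system: a finite ground set (a finite subset of `α`) together with a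
collection of subsets of it, the feasible sets. -/
@[ext]
structure SetSystem (α : Type*) where
  ground : Finset α
  feasible : Finset (Finset α)
  subset_ground : ∀ X ∈ feasible, X ⊆ ground

namespace SetSystem

variable {α : Type*} [DecidableEq α]

/-- A set system is proper if it has a feasible set. -/
def IsProper (S : SetSystem α) : Prop := S.feasible.Nonempty

/-- Delta-matroids: proper set systems satisfying the symmetric exchange axiom
(`v = u` is allowed). -/
def IsDeltaMatroid (S : SetSystem α) : Prop :=
  S.IsProper ∧ ∀ X ∈ S.feasible, ∀ Y ∈ S.feasible, ∀ u ∈ X ∆ Y,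
    ∃ v ∈ X ∆ Y, X ∆ {u, v} ∈ S.feasible

/-- The twist `S * A`. -/
def twist (S : SetSystem α) (A : Finset α) (hA : A ⊆ S.ground) : SetSystem α where
  ground := S.ground
  feasible := S.feasible.image (fun X => X ∆ A)
  subset_ground := by
    intro X hX
    obtain ⟨Y, hY, rfl⟩ := Finset.mem_image.mp hX
    exact symmDiff_le_sup.trans (sup_le (S.subset_ground Y hY) hA)

/-- The loop complementation `S + e` of a set system on an element `e` of its ground set. -/
def loopComp (S : SetSystem α) (e : α) (he : e ∈ S.ground) : SetSystem α where
  ground := S.ground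
  feasible := S.feasible ∆ (S.feasible.filter (fun X => e ∉ X)).image (fun X => insert e X)
  subset_ground := by
    intro X hX
    rcases Finset.mem_symmDiff.mp hX with ⟨h, _⟩ | ⟨h, _⟩
    · exact S.subset_ground X h
    · obtain ⟨Y, hY, rfl⟩ := Finset.mem_image.mp h
      exact Finset.insert_subset he (S.subset_ground Y (Finset.mem_filter.mp hY).1)

/-- `T` arises from `S` by one twist or by one loop complementation on a single element. -/
def TwistedDualStep (S T : SetSystem α) : Prop :=
  (∃ (A : Finset α) (hA : A ⊆ S.ground), T = S.twist A hA) ∨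
    ∃ (e : α) (he : e ∈ S.ground), T = S.loopComp e he

/-- `T` is a twisted dual of `S`: it is obtained from `S` by a finite (possibly empty) sequence
of twists and loop complementations. The loop complementation `S + X` on a set `X` is by
definition the iterated loop complementation on the elements of `X`, so it is covered. -/
def IsTwistedDual (S T : SetSystem α) : Prop :=
  Relation.ReflTransGen TwistedDualStep S T

/-- A delta-matroid is vf-safe if all of its twisted duals are delta-matroids. -/
def IsVfSafe (S : SetSystem α) : Prop :=
  S.IsDeltaMatroid ∧ ∀ T : SetSystem α, IsTwistedDual S T → T.IsDeltaMatroid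

/-- A loop is an element of the ground set that is in no feasible set. -/
def IsLoop (S : SetSystem α) (e : α) : Prop := e ∈ S.ground ∧ ∀ X ∈ S.feasible, e ∉ X

/-- A coloop is an element of the ground set that is in every feasible set. -/
def IsColoop (S : SetSystem α) (e : α) : Prop := e ∈ S.ground ∧ ∀ X ∈ S.feasible, e ∈ X

instance (S : SetSystem α) (e : α) : Decidable (S.IsLoop e) := by
  unfold IsLoop; infer_instance

instance (S : SetSystem α) (e : α) : Decidable (S.IsColoop e) := by
  unfold IsColoop; infer_instance

/-- The set system on `E - e` with feasible sets `F` for `e ∉ F` feasible in `S`. -/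
def restrictAvoiding (S : SetSystem α) (e : α) : SetSystem α where
  ground := S.ground.erase e
  feasible := S.feasible.filter (fun X => e ∉ X)
  subset_ground := by
    intro X hX
    obtain ⟨h, he⟩ := Finset.mem_filter.mp hX
    exact Finset.subset_erase.mpr ⟨S.subset_ground X h, he⟩

/-- The set system on `E - e` with feasible sets `F - e` for `e ∈ F` feasible in `S`. -/
def restrictContaining (S : SetSystem α) (e : α) : SetSystem α where
  ground := S.ground.erase e
  feasible := (S.feasible.filter (fun X => e ∈ X)).image (fun X => X.erase e)
  subset_ground := by
    intro X hX
    obtain ⟨Y, hY, rfl⟩ := Finset.mem_image.mp hX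
    exact Finset.erase_subset_erase e (S.subset_ground Y (Finset.mem_filter.mp hY).1)

/-- The deletion of `e`; for a coloop it is the contraction. -/
def delete (S : SetSystem α) (e : α) : SetSystem α :=
  if S.IsColoop e then S.restrictContaining e else S.restrictAvoiding e

/-- The contraction of `e`; for a loop it is the deletion. -/
def contract (S : SetSystem α) (e : α) : SetSystem α :=
  if S.IsLoop e then S.restrictAvoiding e else S.restrictContaining e

/-- The Penrose contraction `S ‡ e = (S + e) / e`. -/
def penroseContract (S : SetSystem α) (e : α) (he : e ∈ S.ground) : SetSystem α :=
  (S.loopComp e he).contract e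

/-- `T` arises from `S` by one deletion, contraction or Penrose contraction. -/
def ThreeMinorStep (S T : SetSystem α) : Prop :=
  ∃ (e : α) (he : e ∈ S.ground), T = S.delete e ∨ T = S.contract e ∨ T = S.penroseContract e he

/-- `T` is a 3-minor of `S`: it is obtained from `S` by a finite (possibly empty) sequence of
deletions, contractions and Penrose contractions. -/
def IsThreeMinor (S T : SetSystem α) : Prop :=
  Relation.ReflTransGen ThreeMinorStep S T

/-- Set systems are isomorphic if there is a bijection between their ground sets under which
the feasible sets correspond. -/
def IsIsomorphic {β : Type*} [DecidableEq β] (S : SetSystem α) (T : SetSystem β) : Prop :=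
  ∃ φ : S.ground ≃ T.ground, ∀ X : Finset S.ground,
    X.image (fun x : S.ground => (x : α)) ∈ S.feasible ↔
      X.image (fun x : S.ground => (φ x : β)) ∈ T.feasible

/-- The set system `D(M)` on `E` of a binary matrix `M`: a subset `X` of `E` is feasible when the
principal submatrix of `M` on `X` is non-singular (the empty matrix is). Only the entries of `M`
with both indices in `E` matter. -/
def ofMatrix (E : Finset α) (M : Matrix α α (ZMod 2)) : SetSystem α where
  ground := E
  feasible := E.powerset.filter (fun X =>
    (M.submatrix (fun i : X => (i : α)) (fun i : X => (i : α))).det ≠ 0)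
  subset_ground := by
    intro X hX
    exact Finset.mem_powerset.mp (Finset.mem_filter.mp hX).1

/-- A delta-matroid is binary if it is a twist of `D(M)` for some symmetric binary matrix `M`
with rows and columns indexed by its ground set. -/
def IsBinary (S : SetSystem α) : Prop :=
  S.IsDeltaMatroid ∧ ∃ M : Matrix α α (ZMod 2), M.IsSymm ∧
    ∃ (A : Finset α) (hA : A ⊆ S.ground), S = (ofMatrix S.ground M).twist A hA

/-- `B₁ = ({a,b,c}, {∅, {a,b}, {a,c}, {b,c}, {a,b,c}})` with `a, b, c = 0, 1, 2`. -/
def B₁ : SetSystem (Fin 3) where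
  ground := {0, 1, 2}
  feasible := {∅, {0, 1}, {0, 2}, {1, 2}, {0, 1, 2}}
  subset_ground := by decide

end SetSystem

/-!
Call a set system representable if it is a twist of the set system of a symmetric binary matrix.

Representability is preserved by twisted duality and by 3-minors. Any feasible set can serve as the
base of the twist, by the principal pivot transform (`exists_ofMatrix_pivot`). With a base avoiding
`e`, loop complementation on `e` changes a diagonal entry of the matrix and deletion of `e` removes
a row and a column. Contraction and Penrose contraction are deletions in a twisted dual. Since `B₁`
is not representable (a symmetric matrix of order 3 with zero diagonal is singular modulo 2), a
representable set system has no 3-minor isomorphic to a twisted dual of `B₁`.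

Conversely, let `D` be a vf-safe delta-matroid without such a 3-minor that is not representable and
has as few elements as possible. Vf-safety and the absence of excluded 3-minors pass to twisted duals
and to 3-minors, so that the empty set may be assumed feasible and all proper 3-minors are
representable. The feasible sets with at most two elements determine a symmetric matrix `M`, and a
representable set system in which the empty set is feasible is determined by these sets
(`IsRepresentable.eq_of_card_le_two`). Deletions show that `D` and the set system `G` of `M` agree
on all proper subsets of the ground set `E`, so they disagree on `E`, and `E` has at least three
elements.

If `E` has at least four elements, take any `i` in `E`. After a loop complementation on `i` of both
`D` and `G`, if necessary, `{i}` is feasible. Contracting `i` then gives two representable set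
systems in which the empty set is feasible. They agree on the sets with at most two elements but
disagree on `E - {i}`, a contradiction (`IsRepresentable.ground_mem_iff`). If `E` has three elements,
loop complementations make all singletons infeasible; the feasible sets are then `∅`, `E` and some
of the pairs, and vf-safety forces all pairs (`IsVfSafe.pair_mem`), so a twisted dual of `D` is
isomorphic to `B₁`.
-/

namespace SetSystem

variable {α : Type*} [DecidableEq α]

/-! ### Feasible sets of the basic operations -/

theorem mem_twist {S : SetSystem α} {A : Finset α} {hA : A ⊆ S.ground} {X : Finset α} :
    X ∈ (S.twist A hA).feasible ↔ X ∆ A ∈ S.feasible := by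
  simp only [twist, Finset.mem_image]
  constructor
  · rintro ⟨Y, hY, rfl⟩
    simpa using hY
  · intro h
    exact ⟨_, h, by simp⟩

theorem mem_loopComp {S : SetSystem α} {e : α} {he : e ∈ S.ground} {X : Finset α} :
    X ∈ (S.loopComp e he).feasible ↔
      Xor (X ∈ S.feasible) (e ∈ X ∧ X.erase e ∈ S.feasible) := by
  have h : X ∈ (S.feasible.filter (fun X => e ∉ X)).image (fun X => insert e X) ↔
      (e ∈ X ∧ X.erase e ∈ S.feasible) := by
    simp only [Finset.mem_image, Finset.mem_filter]
    constructor
    · rintro ⟨Y, ⟨hY, heY⟩, rfl⟩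
      simp [heY, hY]
    · rintro ⟨h1, h2⟩
      exact ⟨_, ⟨h2, by simp⟩, by simp [h1]⟩
  simp only [loopComp, Finset.mem_symmDiff, h, Xor]

theorem mem_restrictAvoiding {S : SetSystem α} {e : α} {X : Finset α} :
    X ∈ (S.restrictAvoiding e).feasible ↔ e ∉ X ∧ X ∈ S.feasible := by
  simp [restrictAvoiding, and_comm]

theorem mem_restrictContaining {S : SetSystem α} {e : α} {X : Finset α} :
    X ∈ (S.restrictContaining e).feasible ↔ e ∉ X ∧ insert e X ∈ S.feasible := by
  simp only [restrictContaining, Finset.mem_image, Finset.mem_filter]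
  constructor
  · rintro ⟨Y, ⟨hY, heY⟩, rfl⟩
    simp [heY, hY]
  · rintro ⟨h1, h2⟩
    exact ⟨_, ⟨h2, by simp⟩, by simp [h1]⟩

theorem mem_loopComp_restrictContaining {S : SetSystem α} {e : α} {he : e ∈ S.ground}
    {X : Finset α} :
    X ∈ ((S.loopComp e he).restrictContaining e).feasible ↔
      e ∉ X ∧ Xor (insert e X ∈ S.feasible) (X ∈ S.feasible) := by
  rw [mem_restrictContaining, mem_loopComp]
  refine and_congr_right fun h => ?_
  simp [h]

omit [DecidableEq α] in
theorem eq_of_mem_iff {S T : SetSystem α} (hg : S.ground = T.ground)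
    (h : ∀ X, X ∈ S.feasible ↔ X ∈ T.feasible) : S = T :=
  SetSystem.ext hg (Finset.ext h)

theorem eq_twist {S T : SetSystem α} {A : Finset α} {hA : A ⊆ S.ground} (hg : T.ground = S.ground)
    (h : ∀ X, X ∈ T.feasible ↔ X ∆ A ∈ S.feasible) : T = S.twist A hA :=
  eq_of_mem_iff hg fun X => (h X).trans mem_twist.symm

theorem eq_loopComp {S T : SetSystem α} {e : α} {he : e ∈ S.ground} (hg : T.ground = S.ground)
    (h : ∀ X, X ∈ T.feasible ↔ Xor (X ∈ S.feasible) (e ∈ X ∧ X.erase e ∈ S.feasible)) :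
    T = S.loopComp e he :=
  eq_of_mem_iff hg fun X => (h X).trans mem_loopComp.symm

/-! ### Twisted duals -/

theorem twist_twist (S : SetSystem α) {A : Finset α} (hA : A ⊆ S.ground) :
    (S.twist A hA).twist A hA = S :=
  Eq.symm <| by
    refine eq_twist rfl fun X => ?_
    simp [mem_twist]

theorem loopComp_loopComp (S : SetSystem α) {e : α} (he : e ∈ S.ground) :
    (S.loopComp e he).loopComp e he = S :=
  Eq.symm <| by
    refine eq_loopComp rfl fun X => ?_
    simp only [mem_loopComp, Finset.mem_erase, Xor, Finset.erase_idem]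
    tauto

theorem TwistedDualStep.symm {S T : SetSystem α} (h : TwistedDualStep S T) :
    TwistedDualStep T S := by
  rcases h with ⟨A, hA, rfl⟩ | ⟨e, he, rfl⟩
  · exact Or.inl ⟨A, hA, (S.twist_twist hA).symm⟩
  · exact Or.inr ⟨e, he, (S.loopComp_loopComp he).symm⟩

theorem TwistedDualStep.ground_eq {S T : SetSystem α} (h : TwistedDualStep S T) :
    T.ground = S.ground := by
  rcases h with ⟨A, hA, rfl⟩ | ⟨e, he, rfl⟩ <;> rfl

theorem IsTwistedDual.symm {S T : SetSystem α} (h : IsTwistedDual S T) : IsTwistedDual T S := by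
  induction h with
  | refl => exact .refl
  | tail _ h ih => exact .head h.symm ih

theorem IsTwistedDual.ground_eq {S T : SetSystem α} (h : IsTwistedDual S T) :
    T.ground = S.ground := by
  induction h with
  | refl => rfl
  | tail _ h ih => exact h.ground_eq.trans ih

theorem isTwistedDual_twist (S : SetSystem α) {A : Finset α} (hA : A ⊆ S.ground) :
    IsTwistedDual S (S.twist A hA) :=
  .single (Or.inl ⟨A, hA, rfl⟩)

theorem isTwistedDual_loopComp (S : SetSystem α) {e : α} (he : e ∈ S.ground) :
    IsTwistedDual S (S.loopComp e he) :=
  .single (Or.inr ⟨e, he, rfl⟩)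

theorem TwistedDualStep.isProper {S T : SetSystem α} (h : TwistedDualStep S T)
    (hS : S.IsProper) : T.IsProper := by
  obtain ⟨F, hF⟩ := hS
  rcases h with ⟨A, hA, rfl⟩ | ⟨e, he, rfl⟩
  · exact ⟨F ∆ A, by simpa [mem_twist, symmDiff_assoc] using hF⟩
  · by_cases h : e ∈ F ∧ F.erase e ∈ S.feasible
    · exact ⟨F.erase e, mem_loopComp.mpr (by simp [Xor, h.2])⟩
    · exact ⟨F, mem_loopComp.mpr (Or.inl ⟨hF, h⟩)⟩

theorem IsTwistedDual.isProper {S T : SetSystem α} (h : IsTwistedDual S T) (hS : S.IsProper) :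
    T.IsProper := by
  induction h with
  | refl => exact hS
  | tail _ h ih => exact h.isProper ih

theorem IsVfSafe.isTwistedDual {S T : SetSystem α} (hS : S.IsVfSafe) (h : IsTwistedDual S T) :
    T.IsVfSafe :=
  ⟨hS.2 T h, fun _ hU => hS.2 _ (h.trans hU)⟩

/-! ### Minors and twisted duality -/

/-- `T` is one of the three restrictions of `S` at `e`, whose indicator functions are, in terms of
the indicator functions `f₀` and `f₁` of the feasible sets avoiding and containing `e`, the
functions `f₀`, `f₁` and `f₀ + f₁` modulo 2. The three may be improper; the proper ones are the
results of deletion, contraction and Penrose contraction. -/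
def IsSlice (S : SetSystem α) (e : α) (he : e ∈ S.ground) (T : SetSystem α) : Prop :=
  T = S.restrictAvoiding e ∨ T = S.restrictContaining e ∨
    T = (S.loopComp e he).restrictContaining e

/-- The conventions for loops and coloops replace an improper slice by a proper one. -/
theorem threeMinorStep_iff {S T : SetSystem α} (hS : S.IsProper) :
    ThreeMinorStep S T ↔ ∃ (e : α) (he : e ∈ S.ground), T.IsProper ∧ S.IsSlice e he T := by
  obtain ⟨F, hF⟩ := hS
  have key : ∀ (S : SetSystem α) (e : α), e ∈ S.ground → S.IsProper →
      (S.contract e).IsProper ∧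
      (S.contract e = S.restrictContaining e ∨ S.contract e = S.restrictAvoiding e) := by
    rintro S e he ⟨F, hF⟩
    unfold contract
    split_ifs with h
    · exact ⟨⟨F, mem_restrictAvoiding.mpr ⟨h.2 F hF, hF⟩⟩, Or.inr rfl⟩
    · obtain ⟨G, hG, heG⟩ : ∃ G ∈ S.feasible, e ∈ G := by
        by_contra! hc
        exact h ⟨he, hc⟩
      exact ⟨⟨G.erase e, mem_restrictContaining.mpr (by simp [heG, hG])⟩, Or.inl rfl⟩
  constructor
  · rintro ⟨e, he, rfl | rfl | rfl⟩
    · refine ⟨e, he, ?_⟩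
      unfold delete
      split_ifs with h
      · exact ⟨⟨F.erase e, mem_restrictContaining.mpr (by simp [h.2 F hF, hF])⟩, Or.inr (Or.inl rfl)⟩
      · obtain ⟨G, hG, heG⟩ : ∃ G ∈ S.feasible, e ∉ G := by
          by_contra! hc
          exact h ⟨he, hc⟩
        exact ⟨⟨G, mem_restrictAvoiding.mpr ⟨heG, hG⟩⟩, Or.inl rfl⟩
    · obtain ⟨h1, h2⟩ := key S e he ⟨F, hF⟩
      exact ⟨e, he, h1, by unfold IsSlice; tauto⟩
    · obtain ⟨h1, h2⟩ := key (S.loopComp e he) e he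
        ((S.isTwistedDual_loopComp he).isProper ⟨F, hF⟩)
      refine ⟨e, he, h1, ?_⟩
      rcases h2 with h2 | h2
      · exact Or.inr (Or.inr h2)
      · refine Or.inl (h2.trans (eq_of_mem_iff rfl fun X => ?_))
        simp only [mem_restrictAvoiding, mem_loopComp]
        exact and_congr_right fun h => by simp [h, Xor]
  · rintro ⟨e, he, ⟨G, hG⟩, rfl | rfl | rfl⟩
    · refine ⟨e, he, Or.inl ?_⟩
      rw [mem_restrictAvoiding] at hG
      exact (if_neg fun h => hG.1 (h.2 G hG.2)).symm
    · refine ⟨e, he, Or.inr (Or.inl ?_)⟩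
      rw [mem_restrictContaining] at hG
      exact (if_neg fun h => h.2 _ hG.2 (by simp)).symm
    · refine ⟨e, he, Or.inr (Or.inr ?_)⟩
      rw [mem_restrictContaining] at hG
      exact (if_neg fun h => h.2 _ hG.2 (by simp)).symm

theorem restrictContaining_twist (S : SetSystem α) {e : α} {A : Finset α} (hA : A ⊆ S.ground)
    (heA : e ∉ A) (hA' : A ⊆ S.ground.erase e) :
    (S.twist A hA).restrictContaining e = (S.restrictContaining e).twist A hA' :=
  eq_twist rfl fun X => by
    have h : e ∉ X → insert e X ∆ A = insert e (X ∆ A) := fun h => by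
      ext x; simp only [Finset.mem_symmDiff, Finset.mem_insert]; by_cases hx : x = e <;> simp_all
    simp only [mem_twist, mem_restrictContaining, Finset.mem_symmDiff, heA]
    by_cases hX : e ∈ X <;> simp [hX, h]

theorem restrictAvoiding_eq (S : SetSystem α) {e : α} (he : e ∈ S.ground)  :
    S.restrictAvoiding e =
      (S.twist {e} (Finset.singleton_subset_iff.mpr he)).restrictContaining e :=
  eq_of_mem_iff rfl fun X => by
    rw [mem_restrictContaining, mem_restrictAvoiding, mem_twist]
    refine and_congr_right fun h => ?_
    have : insert e X ∆ {e} = X := by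
      ext x; simp only [Finset.mem_symmDiff, Finset.mem_insert, Finset.mem_singleton]
      by_cases hx : x = e <;> simp_all
    rw [this]

theorem restrictContaining_loopComp (S : SetSystem α) {e f : α} (hf : f ∈ S.ground)
    (hf' : f ∈ S.ground.erase e) :
    (S.loopComp f hf).restrictContaining e = (S.restrictContaining e).loopComp f hf' :=
  eq_loopComp rfl fun X => by
    have hfe := Finset.ne_of_mem_erase hf'
    simp only [mem_loopComp, mem_restrictContaining, Finset.mem_insert, hfe, false_or,
      Finset.mem_erase, Finset.erase_insert_of_ne hfe.symm, Xor]
    tauto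

/-- Every twisted dual of `S.restrictContaining e` lifts to a twisted dual of `S`. -/
theorem exists_isTwistedDual_of_restrictContaining {S T : SetSystem α} {e : α}
    (h : IsTwistedDual (S.restrictContaining e) T) :
    ∃ S', IsTwistedDual S S' ∧ T = S'.restrictContaining e := by
  induction h with
  | refl => exact ⟨S, .refl, rfl⟩
  | tail _ h ih =>
    obtain ⟨S', hS', rfl⟩ := ih
    rcases h with ⟨A, hA, rfl⟩ | ⟨f, hf, rfl⟩
    · have hA' : A ⊆ S'.ground := hA.trans (Finset.erase_subset _ _)
      exact ⟨_, hS'.trans (S'.isTwistedDual_twist hA'),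
        (S'.restrictContaining_twist hA' (Finset.subset_erase.mp hA).2 hA).symm⟩
    · have hf' : f ∈ S'.ground := Finset.mem_of_mem_erase hf
      exact ⟨_, hS'.trans (S'.isTwistedDual_loopComp hf'),
        (S'.restrictContaining_loopComp hf' hf).symm⟩

theorem IsDeltaMatroid.restrictContaining {S : SetSystem α} (hS : S.IsDeltaMatroid) {e : α}
    (h : (S.restrictContaining e).IsProper) : (S.restrictContaining e).IsDeltaMatroid := by
  refine ⟨h, fun X hX Y hY u hu => ?_⟩
  rw [mem_restrictContaining] at hX hY
  have h1 : insert e X ∆ insert e Y = X ∆ Y := by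
    ext x; simp only [Finset.mem_symmDiff, Finset.mem_insert]; by_cases hx : x = e <;> simp_all
  obtain ⟨v, hv, hF⟩ := hS.2 _ hX.2 _ hY.2 u (h1 ▸ hu)
  rw [h1] at hv
  have heu : e ≠ u := by rintro rfl; simp [Finset.mem_symmDiff, hX.1, hY.1] at hu
  have hev : e ≠ v := by rintro rfl; simp [Finset.mem_symmDiff, hX.1, hY.1] at hv
  have h2 : insert e X ∆ {u, v} = insert e (X ∆ {u, v}) := by
    ext x
    simp only [Finset.mem_symmDiff, Finset.mem_insert, Finset.mem_singleton]
    by_cases hx : x = e <;> simp_all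
  refine ⟨v, hv, mem_restrictContaining.mpr ⟨?_, h2 ▸ hF⟩⟩
  simp [Finset.mem_symmDiff, hX.1, heu, hev]

theorem IsVfSafe.restrictContaining {S : SetSystem α} (hS : S.IsVfSafe) {e : α}
    (h : (S.restrictContaining e).IsProper) : (S.restrictContaining e).IsVfSafe := by
  refine ⟨hS.1.restrictContaining h, fun T hT => ?_⟩
  have hp := hT.isProper h
  obtain ⟨S', hS', rfl⟩ := exists_isTwistedDual_of_restrictContaining hT
  exact (hS.2 S' hS').restrictContaining hp

theorem IsSlice.exists_isTwistedDual {S T : SetSystem α} {e : α} {he : e ∈ S.ground}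
    (h : S.IsSlice e he T) : ∃ S', IsTwistedDual S S' ∧ T = S'.restrictContaining e := by
  rcases h with rfl | rfl | rfl
  · exact ⟨_, S.isTwistedDual_twist _, S.restrictAvoiding_eq he⟩
  · exact ⟨S, .refl, rfl⟩
  · exact ⟨_, S.isTwistedDual_loopComp he, rfl⟩

theorem IsVfSafe.isSlice {S T : SetSystem α} (hS : S.IsVfSafe) {e : α} {he : e ∈ S.ground}
    (h : S.IsSlice e he T) (hT : T.IsProper) : T.IsVfSafe := by
  obtain ⟨S', hS', rfl⟩ := h.exists_isTwistedDual
  exact (hS.isTwistedDual hS').restrictContaining hT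

/-- A twist or loop complementation permutes the three slices at `e`, up to a twist or loop
complementation away from `e`. -/
theorem TwistedDualStep.exists_isSlice {S S' T' : SetSystem α} (h : TwistedDualStep S S') {e : α}
    {he : e ∈ S'.ground} (hT : S'.IsSlice e he T') :
    ∃ (he' : e ∈ S.ground) (T : SetSystem α), S.IsSlice e he' T ∧ IsTwistedDual T T' := by
  have he' : e ∈ S.ground := h.ground_eq ▸ he
  refine ⟨he', ?_⟩
  rcases h with ⟨A, hA, rfl⟩ | ⟨f, hf, rfl⟩
  · have hB : A.erase e ⊆ S.ground.erase e := Finset.erase_subset_erase e hA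
    have h0 : ∀ X, e ∉ X → e ∉ X ∆ A.erase e := fun X hX => by simp [Finset.mem_symmDiff, hX]
    by_cases heA : e ∈ A
    · have h1 : ∀ X, e ∉ X → X ∆ A = insert e (X ∆ A.erase e) := fun X hX => by
        ext x; simp only [Finset.mem_symmDiff, Finset.mem_insert, Finset.mem_erase]
        by_cases hx : x = e <;> simp_all
      have h2 : ∀ X, e ∉ X → insert e X ∆ A = X ∆ A.erase e := fun X hX => by
        ext x; simp only [Finset.mem_symmDiff, Finset.mem_insert, Finset.mem_erase]
        by_cases hx : x = e <;> simp_all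
      rcases hT with rfl | rfl | rfl
      · refine ⟨_, Or.inr (Or.inl rfl), .single (Or.inl ⟨_, hB, eq_twist rfl fun X => ?_⟩)⟩
        by_cases hX : e ∈ X <;>
          simp [mem_twist, mem_restrictAvoiding, mem_restrictContaining, hX, h0, h1,
            Finset.mem_symmDiff]
      · refine ⟨_, Or.inl rfl, .single (Or.inl ⟨_, hB, eq_twist rfl fun X => ?_⟩)⟩
        by_cases hX : e ∈ X <;>
          simp [mem_twist, mem_restrictAvoiding, mem_restrictContaining, hX, h0, h2,
            Finset.mem_symmDiff]
      · refine ⟨_, Or.inr (Or.inr rfl), .single (Or.inl ⟨_, hB, eq_twist rfl fun X => ?_⟩)⟩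
        by_cases hX : e ∈ X
        · simp [mem_twist, mem_loopComp_restrictContaining, hX, Finset.mem_symmDiff]
        · simp only [mem_twist, mem_loopComp_restrictContaining, hX, h0 X hX, h1 X hX, h2 X hX]
          simp [_root_.xor_comm]
    · have h1 : A.erase e = A := Finset.erase_eq_of_notMem heA
      have h2 : ∀ X, e ∉ X → insert e X ∆ A = insert e (X ∆ A) := fun X hX => by
        ext x; simp only [Finset.mem_symmDiff, Finset.mem_insert]
        by_cases hx : x = e <;> simp_all
      rw [h1] at hB h0
      rcases hT with rfl | rfl | rfl
      · refine ⟨_, Or.inl rfl, .single (Or.inl ⟨_, hB, eq_twist rfl fun X => ?_⟩)⟩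
        simp [mem_twist, mem_restrictAvoiding, Finset.mem_symmDiff, heA]
      · exact ⟨_, Or.inr (Or.inl rfl), .single (Or.inl ⟨_, hB,
          S.restrictContaining_twist hA heA hB⟩)⟩
      · refine ⟨_, Or.inr (Or.inr rfl), .single (Or.inl ⟨_, hB, eq_twist rfl fun X => ?_⟩)⟩
        by_cases hX : e ∈ X
        · simp [mem_twist, mem_loopComp_restrictContaining, hX, Finset.mem_symmDiff, heA]
        · simp only [mem_twist, mem_loopComp_restrictContaining, hX, h0 X hX, h2 X hX]
  · by_cases hfe : f = e
    · subst hfe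
      rcases hT with rfl | rfl | rfl
      · refine ⟨_, Or.inl rfl, ?_⟩
        have : (S.loopComp f hf).restrictAvoiding f = S.restrictAvoiding f :=
          eq_of_mem_iff rfl fun X => by
            by_cases hX : f ∈ X <;> simp [mem_restrictAvoiding, mem_loopComp, hX, Xor]
        rw [this]
        exact .refl
      · exact ⟨_, Or.inr (Or.inr rfl), .refl⟩
      · exact ⟨_, Or.inr (Or.inl rfl), by rw [loopComp_loopComp]; exact .refl⟩
    · have hf' : f ∈ S.ground.erase e := Finset.mem_erase.mpr ⟨hfe, hf⟩
      rcases hT with rfl | rfl | rfl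
      · refine ⟨_, Or.inl rfl, .single (Or.inr ⟨f, hf', eq_loopComp rfl fun X => ?_⟩)⟩
        simp only [mem_loopComp, mem_restrictAvoiding, Finset.mem_erase, Xor]
        tauto
      · exact ⟨_, Or.inr (Or.inl rfl), .single (Or.inr ⟨f, hf',
          S.restrictContaining_loopComp hf hf'⟩)⟩
      · refine ⟨_, Or.inr (Or.inr rfl), .single (Or.inr ⟨f, hf', eq_loopComp rfl fun X => ?_⟩)⟩
        simp only [mem_loopComp, mem_loopComp_restrictContaining, Finset.mem_erase,
          Finset.mem_insert, hfe, false_or, Finset.erase_insert_of_ne (Ne.symm hfe), Xor]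
        grind

theorem IsTwistedDual.exists_isSlice {S S' T' : SetSystem α} (h : IsTwistedDual S S') {e : α}
    {he : e ∈ S'.ground} (hT : S'.IsSlice e he T') :
    ∃ (he' : e ∈ S.ground) (T : SetSystem α), S.IsSlice e he' T ∧ IsTwistedDual T T' := by
  induction h generalizing T' with
  | refl => exact ⟨he, _, hT, .refl⟩
  | tail _ h ih =>
    obtain ⟨he', T, hT, hTT'⟩ := h.exists_isSlice hT
    obtain ⟨he'', U, hU, hUT⟩ := ih hT
    exact ⟨he'', U, hU, hUT.trans hTT'⟩

theorem IsThreeMinor.isProper {S T : SetSystem α} (h : IsThreeMinor S T) (hS : S.IsProper) :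
    T.IsProper := by
  induction h with
  | refl => exact hS
  | tail _ h ih =>
    obtain ⟨e, he, hT, -⟩ := (threeMinorStep_iff ih).mp h
    exact hT

/-- Every 3-minor of a twisted dual of `S` is a twisted dual of a 3-minor of `S`. -/
theorem IsThreeMinor.exists_of_isTwistedDual {S S' T' : SetSystem α} (hS : S.IsProper)
    (h : IsTwistedDual S S') (hT : IsThreeMinor S' T') :
    ∃ T, IsThreeMinor S T ∧ IsTwistedDual T T' := by
  induction hT with
  | refl => exact ⟨S, .refl, h⟩
  | tail hm hs ih =>
    obtain ⟨U, hU, hUT⟩ := ih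
    obtain ⟨e, he, hp, hsl⟩ := (threeMinorStep_iff (IsThreeMinor.isProper hm (h.isProper hS))).mp hs
    obtain ⟨he', T, hT, hTT'⟩ := hUT.exists_isSlice hsl
    refine ⟨T, hU.tail ((threeMinorStep_iff (hU.isProper hS)).mpr
      ⟨e, he', hTT'.symm.isProper hp, hT⟩), hTT'⟩

/-! ### Principal minors of symmetric binary matrices -/

theorem mem_ofMatrix {E X : Finset α} {M : Matrix α α (ZMod 2)} :
    X ∈ (ofMatrix E M).feasible ↔ X ⊆ E ∧
      (M.submatrix (fun i : X => (i : α)) (fun i : X => (i : α))).det ≠ 0 := by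
  simp [ofMatrix]

/-- A principal minor can be computed along any enumeration of its index set. -/
theorem det_submatrix_coe_image {n : ℕ} (M : Matrix α α (ZMod 2)) (f : Fin n → α)
    (hf : f.Injective) {X : Finset α} (hX : ∀ x, x ∈ X ↔ ∃ i, f i = x) :
    (M.submatrix (fun i : X => (i : α)) (fun i : X => (i : α))).det = (M.submatrix f f).det := by
  let φ : Fin n ≃ X := Equiv.ofBijective (fun i => ⟨f i, (hX _).mpr ⟨i, rfl⟩⟩)
    ⟨fun i j h => hf (congrArg Subtype.val h), fun x => by
      obtain ⟨i, hi⟩ := (hX x).mp x.2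
      exact ⟨i, Subtype.ext hi⟩⟩
  rw [← Matrix.det_submatrix_equiv_self φ]
  rfl

theorem empty_mem_ofMatrix (E : Finset α) (M : Matrix α α (ZMod 2)) :
    ∅ ∈ (ofMatrix E M).feasible := by
  simp [mem_ofMatrix, Matrix.det_isEmpty]

theorem singleton_mem_ofMatrix {E : Finset α} {M : Matrix α α (ZMod 2)} {a : α} (ha : a ∈ E) :
    {a} ∈ (ofMatrix E M).feasible ↔ M a a ≠ 0 := by
  rw [mem_ofMatrix, det_submatrix_coe_image M ![a] (Function.injective_of_subsingleton _)
    (by simp [eq_comm]), Matrix.det_fin_one]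
  simp [ha, Matrix.submatrix_apply]

theorem pair_mem_ofMatrix {E : Finset α} {M : Matrix α α (ZMod 2)} {a b : α} (ha : a ∈ E)
    (hb : b ∈ E) (hab : a ≠ b) :
    {a, b} ∈ (ofMatrix E M).feasible ↔ M a a * M b b - M a b * M b a ≠ 0 := by
  rw [mem_ofMatrix, det_submatrix_coe_image M ![a, b] _ (by simp [Fin.exists_fin_two, eq_comm]),
    Matrix.det_fin_two]
  · simp [Finset.insert_subset_iff, ha, hb, Matrix.submatrix_apply]
  · intro i j
    fin_cases i <;> fin_cases j <;> simp [hab, hab.symm]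

/-- A symmetric matrix of order 3 with zero diagonal is singular over the field of two
elements. -/
theorem triple_notMem_ofMatrix {E : Finset α} {M : Matrix α α (ZMod 2)} (hM : M.IsSymm)
    {a b c : α} (hab : a ≠ b) (hac : a ≠ c) (hbc : b ≠ c) (ha : M a a = 0) (hb : M b b = 0)
    (hc : M c c = 0) : {a, b, c} ∉ (ofMatrix E M).feasible := by
  rw [mem_ofMatrix, det_submatrix_coe_image M ![a, b, c] _
    (by simp [Fin.exists_fin_succ, eq_comm])]
  · rintro ⟨-, h⟩
    apply h
    rw [Matrix.det_fin_three]
    simp only [Matrix.submatrix_apply, Matrix.cons_val, ha, hb, hc, hM.apply a b, hM.apply a c,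
      hM.apply b c]
    generalize M a b = x
    generalize M a c = y
    generalize M b c = z
    revert x y z
    decide
  · intro i j
    fin_cases i <;> fin_cases j <;> simp [hab, hac, hbc, hab.symm, hac.symm, hbc.symm]

/-- The matrix whose columns indexed by `X` are those of `N` and whose other columns are those of
the identity matrix. -/
def mixedColumns {E : Finset α} (N : Matrix E E (ZMod 2)) (X : Finset α) : Matrix E E (ZMod 2) :=
  Matrix.of fun i j => if (j : α) ∈ X then N i j else (1 : Matrix E E (ZMod 2)) i j

theorem det_mixedColumns {E X : Finset α} (hX : X ⊆ E) (M : Matrix α α (ZMod 2)) :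
    (mixedColumns (M.submatrix (fun i : E => (i : α)) (fun i : E => (i : α))) X).det =
      (M.submatrix (fun i : X => (i : α)) (fun i : X => (i : α))).det := by
  rw [Matrix.twoBlockTriangular_det' _ (fun i : E => (i : α) ∈ X)]
  · have h1 : (Matrix.toSquareBlockProp
        (mixedColumns (M.submatrix (fun i : E => (i : α)) (fun i : E => (i : α))) X)
        (fun i : E => (i : α) ∉ X)) = 1 := by
      ext i j
      rw [Matrix.toSquareBlockProp_def, Matrix.of_apply, mixedColumns, Matrix.of_apply,
        if_neg j.2, Matrix.one_apply, Matrix.one_apply]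
      simp only [Subtype.ext_iff]
    rw [h1, Matrix.det_one, mul_one]
    let φ : {i : E // (i : α) ∈ X} ≃ X := Equiv.subtypeSubtypeEquivSubtype fun {x} hx => hX hx
    rw [← Matrix.det_submatrix_equiv_self φ]
    congr 1
    ext i j
    simp [Matrix.toSquareBlockProp_def, mixedColumns, j.2, φ]
  · intro i hi j hj
    have : i ≠ j := by rintro rfl; exact hj hi
    simp [mixedColumns, hj, this]

/-- The principal pivot transform of `N` on `B`, the matrix of the twist by `B`. It is meaningful
only if the principal minor of `N` on `B` is non-zero, since the inverse is zero otherwise. -/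
noncomputable def pivot {E : Finset α} (N : Matrix E E (ZMod 2)) (B : Finset α) : Matrix E E (ZMod 2) :=
  (mixedColumns N B)⁻¹ * mixedColumns N (E \ B)

/-- Both sides have the same columns: those of the identity outside `Y`, and those of the pivot
in `Y`. Taking determinants gives the effect of the pivot on principal minors. -/
theorem mixedColumns_pivot {E : Finset α} (N : Matrix E E (ZMod 2)) {B : Finset α}
    (hB : IsUnit (mixedColumns N B).det) (Y : Finset α) :
    mixedColumns (pivot N B) Y = (mixedColumns N B)⁻¹ * mixedColumns N (Y ∆ B) := by
  ext i j
  by_cases hj : (j : α) ∈ Y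
  · simp only [mixedColumns, pivot, Matrix.of_apply, hj, if_true, Matrix.mul_apply,
      Finset.mem_sdiff, j.2, true_and, Finset.mem_symmDiff]
    simp
  · rw [mixedColumns, Matrix.of_apply, if_neg hj, ← Matrix.nonsing_inv_mul _ hB]
    simp only [Matrix.mul_apply]
    refine Finset.sum_congr rfl fun k _ => ?_
    simp [mixedColumns, Finset.mem_symmDiff, hj]

/-- Writing the pivot as `P⁻¹ * Q`, symmetry amounts to `P * Qᵀ = Q * Pᵀ`, which holds because `N`
is symmetric and the characteristic is 2. -/
theorem isSymm_pivot {E : Finset α} {N : Matrix E E (ZMod 2)} (hN : N.IsSymm) {B : Finset α}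
    (hB : IsUnit (mixedColumns N B).det) : (pivot N B).IsSymm := by
  have key : mixedColumns N B * (mixedColumns N (E \ B)).transpose =
      mixedColumns N (E \ B) * (mixedColumns N B).transpose := by
    have h : ∀ P Q : Finset α, (∀ j ∈ E, j ∈ P ↔ j ∉ Q) → ∀ i k : E,
        (mixedColumns N P * (mixedColumns N Q).transpose) i k =
          (if (k : α) ∈ P then N i k else 0) + (if (i : α) ∈ P then 0 else N k i) := by
      intro P Q hPQ i k
      have : ∀ j : E, mixedColumns N P i j * (mixedColumns N Q).transpose j k =
          (if k = j then (if (j : α) ∈ P then N i j else 0) else 0) +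
          (if i = j then (if (j : α) ∈ P then 0 else N k j) else 0) := by
        intro j
        by_cases hj : (j : α) ∈ P
        · have hj' := (hPQ j j.2).mp hj
          simp [mixedColumns, hj, hj', Matrix.one_apply]
        · have hj' : (j : α) ∈ Q := by
            by_contra hc
            exact hj ((hPQ j j.2).mpr hc)
          simp [mixedColumns, hj, hj', Matrix.one_apply]
      rw [Matrix.mul_apply, Finset.sum_congr rfl fun j _ => this j, Finset.sum_add_distrib]
      simp
    ext i k
    rw [h B (E \ B) (fun j hj => by simp [hj]), h (E \ B) B (fun j hj => by simp [hj])]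
    simp only [Finset.mem_sdiff, i.2, k.2, true_and, hN.apply i k]
    -- In the mixed case the two sides differ by `2 * N i k`, which vanishes modulo 2.
    by_cases h1 : (i : α) ∈ B <;> by_cases h2 : (k : α) ∈ B <;>
      simp [h1, h2, CharTwo.add_self_eq_zero]
  have hBt : IsUnit (mixedColumns N B).transpose.det := by rwa [Matrix.det_transpose]
  rw [Matrix.IsSymm, pivot, Matrix.transpose_mul, Matrix.transpose_nonsing_inv]
  calc (mixedColumns N (E \ B)).transpose * (mixedColumns N B).transpose⁻¹
      = (mixedColumns N B)⁻¹ * (mixedColumns N B * (mixedColumns N (E \ B)).transpose) *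
          (mixedColumns N B).transpose⁻¹ := by
        rw [← Matrix.mul_assoc, Matrix.nonsing_inv_mul _ hB, Matrix.one_mul]
    _ = _ := by
        rw [key, ← Matrix.mul_assoc, Matrix.mul_assoc _ _ (mixedColumns N B).transpose⁻¹,
          Matrix.mul_nonsing_inv _ hBt, Matrix.mul_one]

theorem exists_ofMatrix_pivot {E B : Finset α} {M : Matrix α α (ZMod 2)} (hM : M.IsSymm)
    (hB : B ∈ (ofMatrix E M).feasible) :
    ∃ M' : Matrix α α (ZMod 2), M'.IsSymm ∧
      ∀ Y, Y ∈ (ofMatrix E M').feasible ↔ Y ∆ B ∈ (ofMatrix E M).feasible := by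
  obtain ⟨hBE, hdet⟩ := mem_ofMatrix.mp hB
  set N := M.submatrix (fun i : E => (i : α)) (fun i : E => (i : α)) with hN
  have hNs : N.IsSymm := hM.submatrix _
  have hU : IsUnit (mixedColumns N B).det := by
    rw [hN, det_mixedColumns hBE]; exact isUnit_iff_ne_zero.mpr hdet
  have hP := isSymm_pivot hNs hU
  let M' : Matrix α α (ZMod 2) := fun i j =>
    if h : i ∈ E ∧ j ∈ E then pivot N B ⟨i, h.1⟩ ⟨j, h.2⟩ else 0
  have hM' : M'.submatrix (fun i : E => (i : α)) (fun i : E => (i : α)) = pivot N B := by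
    ext i j
    change (if h : (i : α) ∈ E ∧ (j : α) ∈ E then _ else _) = _
    rw [dif_pos ⟨i.2, j.2⟩]
  refine ⟨M', ?_, fun Y => ?_⟩
  · refine Matrix.IsSymm.ext fun i j => ?_
    by_cases hi : i ∈ E <;> by_cases hj : j ∈ E <;> simp [M', hi, hj]
    exact hP.apply _ _
  · have hYE : Y ⊆ E ↔ Y ∆ B ⊆ E := by
      constructor
      · exact fun h => symmDiff_le_sup.trans (sup_le h hBE)
      · intro h
        have : Y = (Y ∆ B) ∆ B := by simp
        rw [this]
        exact symmDiff_le_sup.trans (sup_le h hBE)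
    rw [mem_ofMatrix, mem_ofMatrix, ← hYE]
    refine and_congr_right fun hY => ?_
    rw [← det_mixedColumns hY, hM', mixedColumns_pivot N hU, Matrix.det_mul,
      ← det_mixedColumns (hYE.mp hY), mul_ne_zero_iff, and_iff_right]
    rw [Matrix.det_nonsing_inv, Ring.inverse_eq_inv']
    exact inv_ne_zero hU.ne_zero

/-! ### Set systems represented by a binary matrix -/

/-- The set system is a twist of the set system of a symmetric binary matrix. This is binarity
without the requirement to be a delta-matroid, which plays no role in the closure properties. -/
def IsRepresentable (S : SetSystem α) : Prop :=
  ∃ M : Matrix α α (ZMod 2), M.IsSymm ∧ ∃ A ⊆ S.ground,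
    ∀ X, X ∈ S.feasible ↔ X ∆ A ∈ (ofMatrix S.ground M).feasible

theorem isBinary_iff {S : SetSystem α} (hS : S.IsDeltaMatroid) :
    S.IsBinary ↔ S.IsRepresentable := by
  constructor
  · rintro ⟨-, M, hM, A, hA, h⟩
    refine ⟨M, hM, A, hA, fun X => ?_⟩
    exact (Finset.ext_iff.mp (congrArg feasible h) X).trans mem_twist
  · rintro ⟨M, hM, A, hA, h⟩
    exact ⟨hS, M, hM, A, hA, eq_twist rfl h⟩

theorem isRepresentable_ofMatrix (E : Finset α) {M : Matrix α α (ZMod 2)} (hM : M.IsSymm) :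
    (ofMatrix E M).IsRepresentable :=
  ⟨M, hM, ∅, Finset.empty_subset _, fun X => by
    rw [show X ∆ ∅ = X from symmDiff_bot X]; rfl⟩

/-- Any feasible set can be taken as the base of a representation. -/
theorem IsRepresentable.exists_matrix {S : SetSystem α} (hS : S.IsRepresentable) {F : Finset α}
    (hF : F ∈ S.feasible) : ∃ M : Matrix α α (ZMod 2), M.IsSymm ∧
      ∀ X, X ∈ S.feasible ↔ X ∆ F ∈ (ofMatrix S.ground M).feasible := by
  obtain ⟨M, hM, A, hA, h⟩ := hS
  obtain ⟨M', hM', h'⟩ := exists_ofMatrix_pivot hM ((h F).mp hF)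
  refine ⟨M', hM', fun X => ?_⟩
  rw [h', h]
  congr! 1
  rw [symmDiff_assoc, symmDiff_symmDiff_cancel_left]

theorem IsRepresentable.eq_ofMatrix {S : SetSystem α} (hS : S.IsRepresentable)
    (h : ∅ ∈ S.feasible) : ∃ M : Matrix α α (ZMod 2), M.IsSymm ∧ S = ofMatrix S.ground M := by
  obtain ⟨M, hM, h⟩ := hS.exists_matrix h
  refine ⟨M, hM, eq_of_mem_iff rfl fun X => ?_⟩
  rw [h, show X ∆ ∅ = X from symmDiff_bot X]

theorem IsRepresentable.twist {S : SetSystem α} (hS : S.IsRepresentable) {A : Finset α}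
    (hA : A ⊆ S.ground) : (S.twist A hA).IsRepresentable := by
  obtain ⟨M, hM, B, hB, h⟩ := hS
  refine ⟨M, hM, A ∆ B, symmDiff_le_sup.trans (sup_le hA hB), fun X => ?_⟩
  rw [mem_twist, h, symmDiff_assoc]
  rfl

/-- Loop complementation on `e` adds one to the diagonal entry of the matrix at `e`. -/
theorem mem_ofMatrix_add_single {E X : Finset α} (M : Matrix α α (ZMod 2)) {e : α} (he : e ∈ E) :
    X ∈ (ofMatrix E (M + Matrix.single e e 1)).feasible ↔
      Xor (X ∈ (ofMatrix E M).feasible) (e ∈ X ∧ X.erase e ∈ (ofMatrix E M).feasible) := by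
  have hxor : ∀ x y : ZMod 2, x + y ≠ 0 ↔ (x ≠ 0 ∧ ¬y ≠ 0) ∨ (y ≠ 0 ∧ ¬x ≠ 0) := by decide
  by_cases hX : X ⊆ E
  · have hX' : X.erase e ⊆ E := (Finset.erase_subset e X).trans hX
    simp only [mem_ofMatrix, hX, hX', true_and]
    by_cases heX : e ∈ X
    · simp only [heX, true_and]
      have h1 : (M + Matrix.single e e 1).submatrix (fun i : X => (i : α)) (fun i : X => (i : α)) =
          (M.submatrix (fun i : X => (i : α)) (fun i : X => (i : α))).updateCol ⟨e, heX⟩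
            ((fun i : X => M i e) + fun i : X => if i = ⟨e, heX⟩ then 1 else 0) := by
        ext i j
        by_cases hj : j = ⟨e, heX⟩
        · subst hj
          simp [Matrix.single_apply, Subtype.ext_iff, eq_comm]
        · have : e ≠ j := fun h => hj (Subtype.ext h.symm)
          simp [hj, this]
      have h2 : (M.submatrix (fun i : X => (i : α)) (fun i : X => (i : α))).updateCol ⟨e, heX⟩
          (fun i : X => M i e) = M.submatrix (fun i : X => (i : α)) (fun i : X => (i : α)) := by
        ext i j
        by_cases hj : j = ⟨e, heX⟩
        · subst hj; simp
        · simp [hj]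
      have h3 : (M.submatrix (fun i : X => (i : α)) (fun i : X => (i : α))).updateCol ⟨e, heX⟩
          (fun i : X => if i = ⟨e, heX⟩ then 1 else 0) =
          mixedColumns (M.submatrix (fun i : X => (i : α)) (fun i : X => (i : α)))
            (X.erase e) := by
        ext i j
        by_cases hj : j = ⟨e, heX⟩
        · subst hj
          simp [mixedColumns, Matrix.one_apply]
        · have : (j : α) ≠ e := fun h => hj (Subtype.ext h)
          simp [hj, this, mixedColumns]
      rw [h1, Matrix.det_updateCol_add, h2, h3, det_mixedColumns (Finset.erase_subset e X), hxor]
      rfl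
    · have : (M + Matrix.single e e 1).submatrix (fun i : X => (i : α)) (fun i : X => (i : α)) =
          M.submatrix (fun i : X => (i : α)) (fun i : X => (i : α)) := by
        ext i j
        have : e ≠ i := fun h => heX (h ▸ i.2)
        simp [this]
      simp [this, heX, Xor]
  · have hX' : e ∈ X → ¬ X.erase e ⊆ E := fun _ hc =>
      hX fun x hx => by
        by_cases hxe : x = e
        · exact hxe ▸ he
        · exact hc (Finset.mem_erase.mpr ⟨hxe, hx⟩)
    simp only [mem_ofMatrix, hX, false_and, Xor]
    tauto

theorem isSymm_add_single {M : Matrix α α (ZMod 2)} (hM : M.IsSymm) (e : α) :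
    (M + Matrix.single e e 1).IsSymm := by
  rw [Matrix.IsSymm, Matrix.transpose_add, hM.eq, Matrix.transpose_single]

theorem IsRepresentable.loopComp {S : SetSystem α} (hS : S.IsRepresentable) {e : α}
    (he : e ∈ S.ground) : (S.loopComp e he).IsRepresentable := by
  by_cases h : ∃ F ∈ S.feasible, e ∉ F
  · obtain ⟨F, hF, heF⟩ := h
    obtain ⟨M, hM, h⟩ := hS.exists_matrix hF
    refine ⟨M + Matrix.single e e 1, isSymm_add_single hM e, F, S.subset_ground F hF, fun X => ?_⟩
    change _ ↔ X ∆ F ∈ (ofMatrix S.ground (M + Matrix.single e e 1)).feasible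
    rw [mem_ofMatrix_add_single M he, mem_loopComp, h, h]
    have h1 : e ∈ X ∆ F ↔ e ∈ X := by simp [Finset.mem_symmDiff, heF]
    have h2 : (X ∆ F).erase e = X.erase e ∆ F := by
      ext x
      simp only [Finset.mem_erase, Finset.mem_symmDiff]
      by_cases hx : x = e <;> simp_all
    rw [h1, h2]
  · -- If every feasible set contains `e`, loop complementation on `e` changes nothing.
    push Not at h
    have : S.loopComp e he = S := eq_of_mem_iff rfl fun X => by
      have : X.erase e ∉ S.feasible := fun hc => by simpa using h _ hc
      simp [mem_loopComp, this, Xor]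
    rwa [this]

theorem IsRepresentable.isTwistedDual {S T : SetSystem α} (hS : S.IsRepresentable)
    (h : IsTwistedDual S T) : T.IsRepresentable := by
  induction h with
  | refl => exact hS
  | tail _ h ih =>
    rcases h with ⟨A, hA, rfl⟩ | ⟨e, he, rfl⟩
    · exact ih.twist hA
    · exact ih.loopComp he

theorem IsRepresentable.restrictAvoiding {S : SetSystem α} (hS : S.IsRepresentable) {e : α}
    (h : (S.restrictAvoiding e).IsProper) : (S.restrictAvoiding e).IsRepresentable := by
  obtain ⟨F, hF⟩ := h
  rw [mem_restrictAvoiding] at hF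
  obtain ⟨M, hM, h⟩ := hS.exists_matrix hF.2
  refine ⟨M, hM, F, Finset.subset_erase.mpr ⟨S.subset_ground F hF.2, hF.1⟩, fun X => ?_⟩
  rw [mem_restrictAvoiding, h, mem_ofMatrix, mem_ofMatrix]
  have h1 : e ∈ X ∆ F ↔ e ∈ X := by simp [Finset.mem_symmDiff, hF.1]
  simp only [SetSystem.restrictAvoiding, Finset.subset_erase, h1]
  tauto

/-- By twisted duality every slice is the slice of a representable set system that avoids `e`. -/
theorem IsRepresentable.isSlice {S T : SetSystem α} (hS : S.IsRepresentable) {e : α}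
    {he : e ∈ S.ground} (h : S.IsSlice e he T) (hT : T.IsProper) : T.IsRepresentable := by
  obtain ⟨S', hS', rfl⟩ := h.exists_isTwistedDual
  have he' : e ∈ S'.ground := hS'.ground_eq ▸ he
  have hA : {e} ⊆ S'.ground := Finset.singleton_subset_iff.mpr he'
  have h1 := (S'.twist {e} hA).restrictAvoiding_eq he'
  rw [twist_twist] at h1
  rw [← h1] at hT ⊢
  exact ((hS.isTwistedDual hS').twist hA).restrictAvoiding hT

theorem IsRepresentable.isThreeMinor {S T : SetSystem α} (hS : S.IsRepresentable)
    (hp : S.IsProper) (h : IsThreeMinor S T) : T.IsRepresentable := by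
  induction h with
  | refl => exact hS
  | tail hm h ih =>
    obtain ⟨e, he, hT, hs⟩ := (threeMinorStep_iff (IsThreeMinor.isProper hm hp)).mp h
    exact ih.isSlice hs hT

theorem ofMatrix_congr {E : Finset α} {M N : Matrix α α (ZMod 2)}
    (h : ∀ i ∈ E, ∀ j ∈ E, M i j = N i j) : ofMatrix E M = ofMatrix E N :=
  eq_of_mem_iff rfl fun X => by
    rw [mem_ofMatrix, mem_ofMatrix]
    refine and_congr_right fun hX => ?_
    have : M.submatrix (fun i : X => (i : α)) (fun i : X => (i : α)) =
        N.submatrix (fun i : X => (i : α)) (fun i : X => (i : α)) := by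
      ext i j
      exact h i (hX i.2) j (hX j.2)
    rw [this]

/-- The feasible sets with at most two elements determine the entries of the matrix. -/
theorem IsRepresentable.eq_of_card_le_two {S T : SetSystem α} (hS : S.IsRepresentable)
    (hT : T.IsRepresentable) (hg : S.ground = T.ground) (h : ∅ ∈ S.feasible)
    (hST : ∀ X, X.card ≤ 2 → (X ∈ S.feasible ↔ X ∈ T.feasible)) : S = T := by
  obtain ⟨M, hM, hSM⟩ := hS.eq_ofMatrix h
  obtain ⟨N, hN, hTN⟩ := hT.eq_ofMatrix ((hST ∅ (by simp)).mp h)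
  have h2 : ∀ x y : ZMod 2, (x ≠ 0 ↔ y ≠ 0) → x = y := by decide
  rw [hTN, ← hg] at hST ⊢
  rw [hSM] at hST ⊢
  change ∀ X, X.card ≤ 2 → (X ∈ (ofMatrix S.ground M).feasible ↔
    X ∈ (ofMatrix S.ground N).feasible) at hST
  have hd : ∀ i ∈ S.ground, M i i = N i i := fun i hi => by
    have := hST {i} (by simp)
    rw [singleton_mem_ofMatrix hi, singleton_mem_ofMatrix hi] at this
    exact h2 _ _ this
  refine ofMatrix_congr fun i hi j hj => ?_
  by_cases hij : i = j
  · subst hij; exact hd i hi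
  have := hST {i, j} Finset.card_le_two
  rw [pair_mem_ofMatrix hi hj hij, pair_mem_ofMatrix hi hj hij, hd i hi, hd j hj, hM.apply i j,
    hN.apply i j] at this
  have h3 : ∀ x y z : ZMod 2, z - x * x = z - y * y → x = y := by decide
  exact h3 _ _ _ (h2 _ _ this)

/-! ### Isomorphism and twisted duality -/

theorem IsIsomorphic.symm {β : Type*} [DecidableEq β] {S : SetSystem α} {T : SetSystem β}
    (h : S.IsIsomorphic T) : T.IsIsomorphic S := by
  obtain ⟨φ, h⟩ := h
  refine ⟨φ.symm, fun X => ?_⟩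
  have := h (X.image φ.symm)
  simp only [Finset.image_image, Function.comp_def, Equiv.apply_symm_apply] at this
  exact this.symm

theorem exists_image_val_eq {E A : Finset α} (hA : A ⊆ E) :
    ∃ B : Finset E, B.image (fun x : E => (x : α)) = A := by
  refine ⟨A.subtype (· ∈ E), ?_⟩
  ext x
  simp only [Finset.mem_image, Finset.mem_subtype]
  exact ⟨fun ⟨y, hy, hyx⟩ => hyx ▸ hy, fun hx => ⟨⟨x, hA hx⟩, hx, rfl⟩⟩

theorem TwistedDualStep.exists_isIsomorphic {β : Type*} [DecidableEq β] {S S' : SetSystem α}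
    {T : SetSystem β} (hs : TwistedDualStep S S') (h : S.IsIsomorphic T) :
    ∃ T', TwistedDualStep T T' ∧ S'.IsIsomorphic T' := by
  obtain ⟨φ, h⟩ := h
  have hi : Function.Injective (fun x : S.ground => (x : α)) := Subtype.val_injective
  have hj : Function.Injective (fun x : S.ground => (φ x : β)) :=
    Subtype.val_injective.comp φ.injective
  rcases hs with ⟨A, hA, rfl⟩ | ⟨e, he, rfl⟩
  · obtain ⟨B, hB⟩ := exists_image_val_eq hA
    have hC : B.image (fun x : S.ground => (φ x : β)) ⊆ T.ground := by
      intro y hy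
      obtain ⟨x, -, rfl⟩ := Finset.mem_image.mp hy
      exact (φ x).2
    refine ⟨T.twist _ hC, Or.inl ⟨_, hC, rfl⟩, φ, fun (X : Finset S.ground) => ?_⟩
    refine mem_twist.trans (Iff.trans ?_ mem_twist.symm)
    have h1 := Finset.image_symmDiff X B hi
    have h2 := Finset.image_symmDiff X B hj
    rw [hB] at h1
    refine Iff.trans ?_ ((h (X ∆ B)).trans ?_)
    · rw [h1]; rfl
    · rw [h2]; rfl
  · have hf : (φ ⟨e, he⟩ : β) ∈ T.ground := (φ ⟨e, he⟩).2
    refine ⟨T.loopComp _ hf, Or.inr ⟨_, hf, rfl⟩, φ, fun (X : Finset S.ground) => ?_⟩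
    refine mem_loopComp.trans (Iff.trans ?_ mem_loopComp.symm)
    have h1 := Finset.image_erase hi X ⟨e, he⟩
    have h2 := Finset.image_erase hj X ⟨e, he⟩
    have h3 : e ∈ X.image (fun x : S.ground => (x : α)) ↔ ⟨e, he⟩ ∈ X :=
      hi.mem_finset_image (a := (⟨e, he⟩ : S.ground))
    have h4 : (φ ⟨e, he⟩ : β) ∈ X.image (fun x : S.ground => (φ x : β)) ↔ ⟨e, he⟩ ∈ X :=
      hj.mem_finset_image (a := (⟨e, he⟩ : S.ground))
    have key : Xor (X.image (fun x : S.ground => (x : α)) ∈ S.feasible)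
        (e ∈ X.image (fun x : S.ground => (x : α)) ∧
          (X.image (fun x : S.ground => (x : α))).erase e ∈ S.feasible) ↔
        Xor (X.image (fun x : S.ground => (φ x : β)) ∈ T.feasible)
        ((φ ⟨e, he⟩ : β) ∈ X.image (fun x : S.ground => (φ x : β)) ∧
          (X.image (fun x : S.ground => (φ x : β))).erase (φ ⟨e, he⟩ : β) ∈ T.feasible) := by
      rw [h3, h4, h X, ← h1, ← h2, h]
    exact key

theorem IsTwistedDual.exists_isIsomorphic {β : Type*} [DecidableEq β] {S S' : SetSystem α}
    {T : SetSystem β} (hs : IsTwistedDual S S') (h : S.IsIsomorphic T) :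
    ∃ T', IsTwistedDual T T' ∧ S'.IsIsomorphic T' := by
  induction hs with
  | refl => exact ⟨T, .refl, h⟩
  | tail _ hs ih =>
    obtain ⟨T', hT', hi⟩ := ih
    obtain ⟨T'', hT'', hi'⟩ := hs.exists_isIsomorphic hi
    exact ⟨T'', hT'.tail hT'', hi'⟩

/-! ### The excluded minor -/

/-- The feasible sets of `B₁` are the sets that are not singletons, so that any bijection is an
isomorphism. -/
theorem isIsomorphic_B₁_iff {S : SetSystem α} :
    S.IsIsomorphic B₁ ↔
      S.ground.card = 3 ∧ ∀ X ⊆ S.ground, X ∈ S.feasible ↔ X.card ≠ 1 := by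
  have hB : ∀ X : Finset (Fin 3), X ∈ B₁.feasible ↔ X.card ≠ 1 := by decide
  have key : ∀ (φ : S.ground ≃ B₁.ground) (X : Finset S.ground),
      (X.image (fun x : S.ground => (φ x : Fin 3))).card =
        (X.image (fun x : S.ground => (x : α))).card := fun φ X => by
    rw [Finset.card_image_of_injective _ Subtype.val_injective,
      Finset.card_image_of_injective (f := fun x : S.ground => (φ x : Fin 3)) _
        (Subtype.val_injective.comp φ.injective)]
  constructor
  · rintro ⟨φ, h⟩
    refine ⟨?_, fun X hX => ?_⟩
    · have := Fintype.card_congr φ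
      rw [Fintype.card_coe, Fintype.card_coe] at this
      exact this
    · obtain ⟨Y, rfl⟩ := exists_image_val_eq hX
      rw [h, hB, key]
  · rintro ⟨h3, h⟩
    refine ⟨Finset.equivOfCardEq h3, fun X => ?_⟩
    rw [hB, key]
    refine h _ fun y hy => ?_
    obtain ⟨x, -, rfl⟩ := Finset.mem_image.mp hy
    exact x.2

theorem not_isRepresentable_of_isIsomorphic_B₁ {S : SetSystem α} (h : S.IsIsomorphic B₁) :
    ¬ S.IsRepresentable := by
  intro hS
  obtain ⟨h3, h⟩ := isIsomorphic_B₁_iff.mp h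
  obtain ⟨M, hM, hSM⟩ := hS.eq_ofMatrix ((h ∅ (by simp)).mpr (by simp))
  have hd : ∀ a ∈ S.ground, M a a = 0 := fun a ha => by
    by_contra hc
    rw [← ne_eq, ← singleton_mem_ofMatrix ha, ← hSM, h _ (by simpa using ha)] at hc
    simp at hc
  have hmem : S.ground ∈ S.feasible := (h _ subset_rfl).mpr (by omega)
  obtain ⟨a, b, c, hab, hac, hbc, hg⟩ := Finset.card_eq_three.mp h3
  have hm : ∀ x, x ∈ S.ground ↔ x = a ∨ x = b ∨ x = c := by simp [hg]
  refine triple_notMem_ofMatrix (E := S.ground) hM hab hac hbc (hd a ?_) (hd b ?_) (hd c ?_) ?_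
  · simp [hm]
  · simp [hm]
  · simp [hm]
  · rwa [← hg, ← hSM]

/-- Some 3-minor of `S` is isomorphic to a twisted dual of `B₁`. -/
def HasExcludedMinor (S : SetSystem α) : Prop :=
  ∃ (U : SetSystem α) (T : SetSystem (Fin 3)),
    S.IsThreeMinor U ∧ B₁.IsTwistedDual T ∧ U.IsIsomorphic T

theorem HasExcludedMinor.of_isThreeMinor {S U : SetSystem α} (hU : U.HasExcludedMinor)
    (h : IsThreeMinor S U) : S.HasExcludedMinor := by
  obtain ⟨V, T, hV, hT, hi⟩ := hU
  exact ⟨V, T, h.trans hV, hT, hi⟩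

theorem HasExcludedMinor.of_isTwistedDual {S S' : SetSystem α} (hS' : S'.HasExcludedMinor)
    (hS : S.IsProper) (h : IsTwistedDual S S') : S.HasExcludedMinor := by
  obtain ⟨U', T', hU', hT', hi⟩ := hS'
  obtain ⟨U, hU, hUU'⟩ := hU'.exists_of_isTwistedDual hS h
  obtain ⟨T, hT, hi'⟩ := hUU'.symm.exists_isIsomorphic hi
  exact ⟨U, T, hU, hT'.trans hT, hi'⟩

theorem IsRepresentable.not_hasExcludedMinor {S : SetSystem α} (hS : S.IsRepresentable)
    (hp : S.IsProper) : ¬ S.HasExcludedMinor := by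
  rintro ⟨U, T, hU, hT, hi⟩
  obtain ⟨V, hV, hiV⟩ := hT.symm.exists_isIsomorphic hi.symm
  exact not_isRepresentable_of_isIsomorphic_B₁ hiV.symm
    ((hS.isThreeMinor hp hU).isTwistedDual hV)

/-! ### Set systems with three elements -/

/-- Loop complementations make all singletons infeasible, provided that the empty set is
feasible. -/
theorem exists_isTwistedDual_singleton_notMem {S : SetSystem α} (h : ∅ ∈ S.feasible)
    (A : Finset α) (hA : A ⊆ S.ground) :
    ∃ T, IsTwistedDual S T ∧ ∅ ∈ T.feasible ∧ ∀ a ∈ A, {a} ∉ T.feasible := by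
  induction A using Finset.induction_on with
  | empty => exact ⟨S, .refl, h, by simp⟩
  | insert a A haA ih =>
    obtain ⟨T, hT, h0, h1⟩ := ih ((Finset.subset_insert a A).trans hA)
    by_cases ha : {a} ∈ T.feasible
    · have haT : a ∈ T.ground := T.subset_ground _ ha (by simp)
      refine ⟨_, hT.trans (T.isTwistedDual_loopComp haT), ?_, fun b hb => ?_⟩
      · simpa [mem_loopComp, Xor] using h0
      · rw [mem_loopComp]
        by_cases hab : b = a
        · subst hab
          simp [ha, h0, Xor]
        · have := h1 b (Finset.mem_of_mem_insert_of_ne hb hab)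
          simp [this, Ne.symm hab, Xor]
    · refine ⟨T, hT, h0, fun b hb => ?_⟩
      rcases Finset.mem_insert.mp hb with rfl | hb
      · exact ha
      · exact h1 b hb

/-- The symmetric matrix determined by the feasible sets with at most two elements. -/
theorem exists_ofMatrix_card_le_two {S : SetSystem α} (h : ∅ ∈ S.feasible) :
    ∃ M : Matrix α α (ZMod 2), M.IsSymm ∧
      ∀ X, X.card ≤ 2 → (X ∈ S.feasible ↔ X ∈ (ofMatrix S.ground M).feasible) := by
  let d : α → ZMod 2 := fun i => if {i} ∈ S.feasible then 1 else 0
  let M : Matrix α α (ZMod 2) := fun i j =>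
    if i = j then d i else (if {i, j} ∈ S.feasible then 1 else 0) + d i * d j
  refine ⟨M, Matrix.IsSymm.ext fun i j => ?_, fun X hX => ?_⟩
  · by_cases hij : i = j
    · rw [hij]
    · simp only [M, hij, Ne.symm hij, if_false, Finset.pair_comm j i, mul_comm (d j)]
  · by_cases hXg : X ⊆ S.ground
    · have hd : ∀ i, M i i = d i := fun i => by simp [M]
      interval_cases hc : X.card
      · rw [Finset.card_eq_zero.mp hc]
        exact iff_of_true h (empty_mem_ofMatrix _ _)
      · obtain ⟨a, rfl⟩ := Finset.card_eq_one.mp hc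
        rw [singleton_mem_ofMatrix (by simpa using hXg), hd]
        simp [d]
      · obtain ⟨a, b, hab, rfl⟩ := Finset.card_eq_two.mp hc
        rw [Finset.insert_subset_iff, Finset.singleton_subset_iff] at hXg
        rw [pair_mem_ofMatrix hXg.1 hXg.2 hab, hd, hd]
        simp only [M, hab, Ne.symm hab, if_false, Finset.pair_comm b a, mul_comm (d b)]
        generalize d a * d b = x
        have h2 : ∀ x : ZMod 2, x - (1 + x) * (1 + x) ≠ 0 ∧ x - (0 + x) * (0 + x) = 0 := by
          decide
        by_cases hF : {a, b} ∈ S.feasible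
        · simpa [hF] using (h2 x).1
        · simpa [hF] using (h2 x).2
    · exact iff_of_false (fun hc => hXg (S.subset_ground X hc))
        (fun hc => hXg ((ofMatrix S.ground M).subset_ground X hc))

/-- If `{a, c}` were infeasible, the exchange axiom would make `{a, b}` and `{b, c}` feasible, and
would then fail after loop complementation on `a`. -/
theorem IsVfSafe.pair_mem {S : SetSystem α} (hS : S.IsVfSafe) (h0 : ∅ ∈ S.feasible)
    (h1 : ∀ a ∈ S.ground, {a} ∉ S.feasible) {a b c : α} (hab : a ≠ b) (hac : a ≠ c) (hbc : b ≠ c)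
    (hg : S.ground = {a, b, c}) (h3 : {a, b, c} ∈ S.feasible) : {a, c} ∈ S.feasible := by
  by_contra hn
  have ha : a ∈ S.ground := by simp [hg]
  have hc : c ∈ S.ground := by simp [hg]
  have hb : b ∈ S.ground := by simp [hg]
  have hsd : (∅ : Finset α) ∆ {a, b, c} = {a, b, c} := bot_symmDiff _
  have hab' : {a, b} ∈ S.feasible := by
    obtain ⟨v, hv, hF⟩ := hS.1.2 ∅ h0 _ h3 a (by simp [hsd])
    rw [hsd] at hv
    rw [show (∅ : Finset α) ∆ {a, v} = {a, v} from bot_symmDiff _] at hF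
    simp only [Finset.mem_insert, Finset.mem_singleton] at hv
    rcases hv with rfl | rfl | rfl
    · exact absurd (by simpa using hF) (h1 v ha)
    · exact hF
    · exact absurd hF hn
  have hbc' : {b, c} ∈ S.feasible := by
    obtain ⟨v, hv, hF⟩ := hS.1.2 ∅ h0 _ h3 c (by simp [hsd])
    rw [hsd] at hv
    rw [show (∅ : Finset α) ∆ {c, v} = {c, v} from bot_symmDiff _] at hF
    simp only [Finset.mem_insert, Finset.mem_singleton] at hv
    rcases hv with rfl | rfl | rfl
    · exact absurd (Finset.pair_comm c v ▸ hF) hn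
    · exact Finset.pair_comm c v ▸ hF
    · exact absurd (by simpa using hF) (h1 v hc)
  have hdm := hS.2 _ (S.isTwistedDual_loopComp ha)
  have hX : {a} ∈ (S.loopComp a ha).feasible := by
    simp [mem_loopComp, h1 a ha, h0, Xor]
  have hY : {b, c} ∈ (S.loopComp a ha).feasible := by
    simp [mem_loopComp, hbc', hab, hac, Xor]
  have hXY : ({a} : Finset α) ∆ {b, c} = {a, b, c} := by
    ext x; simp only [Finset.mem_symmDiff, Finset.mem_insert, Finset.mem_singleton]
    grind
  obtain ⟨v, hv, hF⟩ := hdm.2 _ hX _ hY c (by simp [hXY])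
  rw [hXY] at hv
  simp only [Finset.mem_insert, Finset.mem_singleton] at hv
  rcases hv with rfl | rfl | rfl
  · have : ({v} : Finset α) ∆ {c, v} = {c} := by
      ext x; simp only [Finset.mem_symmDiff, Finset.mem_insert, Finset.mem_singleton]
      grind
    rw [this, mem_loopComp] at hF
    simp [h1 c hc, hac, Xor] at hF
  · have : ({a} : Finset α) ∆ {c, v} = {a, v, c} := by
      ext x; simp only [Finset.mem_symmDiff, Finset.mem_insert, Finset.mem_singleton]
      grind
    rw [this, mem_loopComp] at hF
    simp [h3, hbc', hab, hac, Xor] at hF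
  · have : ({a} : Finset α) ∆ {v, v} = {a, v} := by
      ext x; simp only [Finset.mem_symmDiff, Finset.mem_insert, Finset.mem_singleton]
      grind
    rw [this, mem_loopComp] at hF
    simp [hn, h1 v hc, hac, Xor] at hF

/-- After loop complementations that make all singletons infeasible, the remaining feasible sets are
forced to be all pairs and the whole ground set. -/
theorem IsVfSafe.exists_isIsomorphic_B₁ {S : SetSystem α} (hS : S.IsVfSafe)
    (hr : ¬ S.IsRepresentable) (h0 : ∅ ∈ S.feasible) (hc : S.ground.card = 3) :
    ∃ T, IsTwistedDual S T ∧ T.IsIsomorphic B₁ := by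
  obtain ⟨T, hT, h0, h1⟩ := exists_isTwistedDual_singleton_notMem h0 S.ground subset_rfl
  refine ⟨T, hT, ?_⟩
  rw [← hT.ground_eq] at h1 hc
  replace hS := hS.isTwistedDual hT
  replace hr : ¬ T.IsRepresentable := fun h => hr (h.isTwistedDual hT.symm)
  obtain ⟨a, b, c, hab, hac, hbc, hg⟩ := Finset.card_eq_three.mp hc
  have h3 : {a, b, c} ∈ T.feasible := by
    by_contra h3
    obtain ⟨M, hM, hTM⟩ := exists_ofMatrix_card_le_two h0
    have hd : ∀ x ∈ T.ground, M x x = 0 := fun x hx => by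
      by_contra hn
      exact h1 x hx ((hTM {x} (by simp)).mpr ((singleton_mem_ofMatrix hx).mpr hn))
    apply hr
    have : T = ofMatrix T.ground M := by
      refine eq_of_mem_iff rfl fun X => ?_
      by_cases hX : X.card ≤ 2
      · exact hTM X hX
      by_cases hXg : X ⊆ T.ground
      · rw [Finset.eq_of_subset_of_card_le hXg (by omega), hg]
        refine iff_of_false h3 (triple_notMem_ofMatrix hM hab hac hbc ?_ ?_ ?_) <;>
          exact hd _ (by simp [hg])
      · exact iff_of_false (fun hc => hXg (T.subset_ground X hc))
          (fun hc => hXg ((ofMatrix T.ground M).subset_ground X hc))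
    rw [this]
    exact isRepresentable_ofMatrix _ hM
  rw [isIsomorphic_B₁_iff]
  refine ⟨hc, fun X hX => ?_⟩
  have hle := Finset.card_le_card hX
  have hpair : ∀ x y, x ∈ T.ground → y ∈ T.ground → x ≠ y → {x, y} ∈ T.feasible := by
    intro x y hx hy hxy
    obtain ⟨z, hz⟩ : ∃ z, T.ground \ {x, y} = {z} := by
      rw [← Finset.card_eq_one,
        Finset.card_sdiff_of_subset (by simp [Finset.insert_subset_iff, hx, hy]),
        Finset.card_pair hxy, hc]
    have hz' : ∀ w, (w ∈ T.ground ∧ w ≠ x ∧ w ≠ y) ↔ w = z := fun w => by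
      simpa using Finset.ext_iff.mp hz w
    have hzz := (hz' z).mpr rfl
    have hg' : T.ground = {x, z, y} := by
      ext w
      have := hz' w
      simp only [Finset.mem_insert, Finset.mem_singleton]
      grind
    exact hS.pair_mem h0 h1 hzz.2.1.symm hxy hzz.2.2 hg' (by rwa [← hg', hg])
  rw [hc] at hle
  interval_cases hXc : X.card
  · simpa [Finset.card_eq_zero.mp hXc] using h0
  · obtain ⟨x, rfl⟩ := Finset.card_eq_one.mp hXc
    simpa using h1 x (by simpa using hX)
  · obtain ⟨x, y, hxy, rfl⟩ := Finset.card_eq_two.mp hXc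
    simpa using hpair x y (hX (by simp)) (hX (by simp)) hxy
  · rw [Finset.eq_of_subset_of_card_le hX (by omega), hg]
    simpa using h3

/-! ### Minimal non-representable set systems -/

/-- If `{i}` is feasible and there are at least four elements, then the contraction of `i` detects
a disagreement with a representable set system on the whole ground set. -/
theorem IsRepresentable.ground_mem_iff {S T : SetSystem α} (hT : T.IsRepresentable)
    (hg : S.ground = T.ground) (hc : 4 ≤ S.ground.card)
    (hST : ∀ X ⊆ S.ground, X ≠ S.ground → (X ∈ S.feasible ↔ X ∈ T.feasible)) {i : α}
    (hi : {i} ∈ S.feasible)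
    (hr : (S.restrictContaining i).IsProper → (S.restrictContaining i).IsRepresentable) :
    S.ground ∈ S.feasible ↔ S.ground ∈ T.feasible := by
  have hiS : i ∈ S.ground := S.subset_ground _ hi (by simp)
  have hag : ∀ X, X.card ≤ 3 → (X ∈ S.feasible ↔ X ∈ T.feasible) := fun X hX => by
    by_cases hXS : X ⊆ S.ground
    · refine hST X hXS ?_
      rintro rfl
      omega
    · exact iff_of_false (fun hc => hXS (S.subset_ground X hc))
        (fun hc => hXS (hg ▸ T.subset_ground X hc))
  have hS0 : ∅ ∈ (S.restrictContaining i).feasible := mem_restrictContaining.mpr (by simpa using hi)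
  have hT0 : ∅ ∈ (T.restrictContaining i).feasible :=
    mem_restrictContaining.mpr (by simpa using (hag {i} (by simp)).mp hi)
  have heq : S.restrictContaining i = T.restrictContaining i := by
    refine (hr ⟨_, hS0⟩).eq_of_card_le_two (hT.isSlice (he := hg ▸ hiS) (Or.inr (Or.inl rfl))
      ⟨_, hT0⟩) (congrArg (Finset.erase · i) hg) hS0 fun X hX => ?_
    rw [mem_restrictContaining, mem_restrictContaining,
      hag _ ((Finset.card_insert_le i X).trans (by omega))]
  have := congrArg (fun U : SetSystem α => S.ground.erase i ∈ U.feasible) heq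
  simpa [mem_restrictContaining, Finset.insert_erase hiS] using this

/-- A smallest counterexample with `∅` feasible differs from the set system of a matrix exactly in
the status of its whole ground set. Three elements lead to `B₁`, and for more elements a contraction
or Penrose contraction that keeps `∅` feasible is a smaller counterexample. -/
theorem IsVfSafe.isRepresentable {S : SetSystem α} (hS : S.IsVfSafe)
    (h : ¬ S.HasExcludedMinor) : S.IsRepresentable := by
  induction hn : S.ground.card using Nat.strong_induction_on generalizing S with
  | _ n ih =>
  -- Twisting by a feasible set makes the empty set feasible.
  wlog h0 : ∅ ∈ S.feasible generalizing S
  · obtain ⟨F, hF⟩ := hS.1.1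
    have htd := S.isTwistedDual_twist (S.subset_ground F hF)
    exact (this (hS.isTwistedDual htd) (fun hc => h (hc.of_isTwistedDual hS.1.1 htd)) hn
      (by rwa [mem_twist, show ∅ ∆ F = F from bot_symmDiff F])).isTwistedDual htd.symm
  have ih' : ∀ {U T : SetSystem α} {e : α} {he : e ∈ U.ground}, IsTwistedDual S U →
      U.IsSlice e he T → T.IsProper → T.IsRepresentable := by
    intro U T e he hU hs hT
    have hUv := hS.isTwistedDual hU
    refine ih T.ground.card ?_ (hUv.isSlice hs hT) (fun hc => h ?_) rfl
    · have hg : T.ground = U.ground.erase e := by rcases hs with rfl | rfl | rfl <;> rfl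
      rw [hg, ← hn, ← hU.ground_eq]
      exact Finset.card_erase_lt_of_mem he
    · exact (hc.of_isThreeMinor (.single ((threeMinorStep_iff hUv.1.1).mpr ⟨e, he, hT, hs⟩)))
        |>.of_isTwistedDual hS.1.1 hU
  by_contra hr
  obtain ⟨M, hM, hSM⟩ := exists_ofMatrix_card_le_two h0
  set G := ofMatrix S.ground M with hG
  have hGr : G.IsRepresentable := isRepresentable_ofMatrix _ hM
  have hag : ∀ X ⊆ S.ground, X ≠ S.ground → (X ∈ S.feasible ↔ X ∈ G.feasible) := by
    intro X hX hne
    obtain ⟨e, he, heX⟩ := Finset.exists_of_ssubset (hX.ssubset_of_ne hne)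
    have hS0 : ∅ ∈ (S.restrictAvoiding e).feasible := mem_restrictAvoiding.mpr ⟨by simp, h0⟩
    have hG0 : ∅ ∈ (G.restrictAvoiding e).feasible :=
      mem_restrictAvoiding.mpr ⟨by simp, empty_mem_ofMatrix _ _⟩
    have heq : S.restrictAvoiding e = G.restrictAvoiding e := by
      refine (ih' (he := he) .refl (Or.inl rfl) ⟨_, hS0⟩).eq_of_card_le_two
        (hGr.restrictAvoiding ⟨_, hG0⟩) rfl hS0 fun X hX => ?_
      rw [mem_restrictAvoiding, mem_restrictAvoiding, hSM X hX]
    have := congrArg (fun U : SetSystem α => X ∈ U.feasible) heq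
    simpa [mem_restrictAvoiding, heX] using this
  have hne : ¬ (S.ground ∈ S.feasible ↔ S.ground ∈ G.feasible) := by
    intro hc
    have : S = G := by
      refine eq_of_mem_iff rfl fun X => ?_
      by_cases hX : X ⊆ S.ground
      · by_cases hXg : X = S.ground
        · rw [hXg, hc]
        · exact hag X hX hXg
      · exact iff_of_false (fun hc => hX (S.subset_ground X hc))
          (fun hc => hX (G.subset_ground X hc))
    exact hr (this ▸ hGr)
  rcases Nat.lt_trichotomy S.ground.card 3 with hlt | h3 | hgt
  · exact hne (hSM _ (by omega))
  · obtain ⟨T, hT, hi⟩ := hS.exists_isIsomorphic_B₁ hr h0 h3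
    obtain ⟨B, hB, hi'⟩ := hT.symm.exists_isIsomorphic hi
    exact h ⟨S, B, .refl, hB, hi'⟩
  · obtain ⟨i, hi⟩ : S.ground.Nonempty := Finset.card_pos.mp (by omega)
    by_cases hiF : {i} ∈ S.feasible
    · exact hne (hGr.ground_mem_iff rfl hgt hag hiF (ih' (he := hi) .refl (Or.inr (Or.inl rfl))))
    · -- Loop complementation on `i` makes `{i}` feasible and keeps the disagreement between
      -- `S` and `G` on the whole ground set.
      have hiG : i ∈ G.ground := hi
      have hE : S.ground.erase i ∈ S.feasible ↔ S.ground.erase i ∈ G.feasible :=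
        hag _ (Finset.erase_subset _ _) (Finset.erase_ssubset hi).ne
      have key := (hGr.loopComp hiG).ground_mem_iff (S := S.loopComp i hi) rfl hgt
        (fun X hX hXg => ?_) (i := i) (by simp [mem_loopComp, hiF, h0, Xor])
        (ih' (U := S.loopComp i hi) (he := hi) (S.isTwistedDual_loopComp hi) (Or.inr (Or.inl rfl)))
      · change S.ground ∈ _ ↔ S.ground ∈ _ at key
        rw [mem_loopComp, mem_loopComp, hE] at key
        simp only [Xor] at key
        tauto
      · have hXi : X.erase i ∈ S.feasible ↔ X.erase i ∈ G.feasible := by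
          refine hag _ ((Finset.erase_subset _ _).trans hX) fun hc => ?_
          have := hc ▸ hi
          simp at this
        rw [mem_loopComp, mem_loopComp, hag X hX hXg, hXi]

end SetSystem

theorem mainTheorem4 {α : Type*} [DecidableEq α] (D : SetSystem α) (hD : D.IsVfSafe) :
    D.IsBinary ↔
      ¬ ∃ (S : SetSystem α) (T : SetSystem (Fin 3)),
        D.IsThreeMinor S ∧ SetSystem.B₁.IsTwistedDual T ∧ S.IsIsomorphic T := by
  rw [SetSystem.isBinary_iff hD.1]
  exact ⟨fun h => h.not_hasExcludedMinor hD.1.1, fun h => hD.isRepresentable h⟩
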